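/- Let $k$ be a countable field of characteristic zero, and let $(a_i)_{i\ge 0}$ be a sequence in $k$ with $a_0=0$, $a_1=1$ and $\{a_i : i\ge 2\}=k\setminus\{0\}$ (repetitions allowed; such sequences exist, even with $a_2,a_3,\dots$ pairwise distinct). Put $$\varphi_1=1+\sum_{i\ge 2}t^i,\qquad \varphi_2=t+\sum_{i\ge 2}a_it^i\ \in k[[t]].$$ Notation. Let $k_{1,1}=k[[t]][x_0,x_1,x_2,\dots]$ be the ring of differential polynomials, with the derivation extending $d/dt$ and sending $x_j$ to $x_{j+1}$; $[\Sigma]$ denotes the smallest ideal containing $\Sigma\subset k_{1,1}$ and closed under the derivation, and $\mathrm{Sol}(\Sigma)\subset k[[t]]$ the set of power series $y$ with $P(y,y',y'',\dots)=0$ for all $P\in\Sigma$. Let $\mathcal T(y)\subset\mathbb N$ be the support of $y\in k[[t]]$. The set $2^{\mathbb N}$ is a differential semiring with union as sum, Minkowski sum as product, and derivative $S\mapsto\{j-1 : j\in S,\ j>0\}$; put $\mathrm{New}(S)=\mathrm{conv}(S+\mathbb N)\subset\mathbb R$, and let $V$ be the quotient map of $2^{\mathbb N}$ by the congruence $\mathrm{New}(S)=\mathrm{New}(S')$.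 For $P=\sum_M\alpha_ME_M\in k_{1,1}$ with distinct differential monomials $E_M$, set $\mathrm{trop}(P)=\sum_M\mathcal T(\alpha_M)E_M$. A set $S\subset\mathbb N$ is a solution of $p=\sum_M A_ME_M$ (with $\emptyset\ne A_M\subset\mathbb N$) if the finite sum $\bigoplus_M V(A_M\,E_M(S))$ does not change when any one of its summands is omitted; $\mathrm{Sol}(U)$ is the set of common solutions of all $p\in U$. Then the following hold. 1. There are unique $\gamma=\sum_i c_it^i$ and $\beta=\sum_i b_it^i$ in $k[[t]]$ that satisfy, for all $i\ge 0$, $$c_i=-\Big((i+2)(i+1)a_{i+2}+\sum_{j=0}^{i-1}(i+1-j)\,c_j\,a_{i+1-j}+\sum_{j=0}^{i-1}b_j\,a_{i-j}\Big),$$ $$b_i=-\Big((i+2)(i+1)+\sum_{j=0}^{i-1}(i+1-j)\,c_j+\sum_{j=0}^{i-2}b_j\Big).$$ 2. For $\Sigma=\{x_2+\gamma x_1+\beta x_0\}$, that is, for the equation $y''+\gamma y'+\beta y=0$, the solution space $\mathrm{Sol}(\Sigma)$ is the $k$-linear span of the linearly independent series $\varphi_1,\varphi_2$, and this is the only equation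 $y''+\gamma'y'+\beta'y=0$ with $\gamma',\beta'\in k[[t]]$ that has this solution space. 3. $\mathcal T(\varphi_1)=\mathbb N\setminus\{1\}$ and $\mathcal T(\varphi_2)=\mathbb N\setminus\{0\}$. If $a_2,a_3,\dots$ are pairwise distinct, then the support of every nonzero solution is $\mathbb N\setminus\{j\}$ for some $j\in\mathbb N$. 4. $\mathcal T(\varphi_1)\cup\mathcal T(\varphi_2)=\mathbb N$ is a tropical solution, $\mathbb N\in\mathrm{Sol}(\mathrm{trop}([\Sigma]))$, but $\mathbb N$ is not the support of any element of $\mathrm{Sol}(\Sigma)$. Hence $\mathcal T(\mathrm{Sol}(\Sigma))\neq\mathrm{Sol}(\mathrm{trop}([\Sigma]))$: over every countable field of characteristic zero, the fundamental theorem of tropical differential algebraic geometry fails already for a single homogeneous linear ordinary differential equation. -/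

import Mathlib

open scoped PowerSeries

noncomputable section

namespace TropDiff

/-! ### Differential polynomials in one indeterminate over `K⟦t⟧`, with derivation `d/dt` -/

/-- The ring `K⟦t⟧[x₀, x₁, x₂, …]` of ordinary differential polynomials in one differential
indeterminate `x`; the variable `X j` stands for the `j`-th derivative of `x`. -/
abbrev DiffPoly (K : Type*) [Field K] : Type _ := MvPolynomial ℕ K⟦X⟧

section Classical

variable {K : Type*} [Field K]

/-- The derivation of `DiffPoly K` which extends `d/dt` on the coefficients and sends `X j` to
`X (j + 1)`: differentiate the coefficients, and add the `K⟦t⟧`-linear derivation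
`X j ↦ X (j + 1)`. -/
def totalDeriv (P : DiffPoly K) : DiffPoly K :=
  (∑ M ∈ P.support, MvPolynomial.monomial M (PowerSeries.derivative K (MvPolynomial.coeff M P)))
    + MvPolynomial.mkDerivation K⟦X⟧ (fun j : ℕ => (MvPolynomial.X (j + 1) : DiffPoly K)) P

/-- The differential ideal `[S]`: the smallest ideal that contains `S` and is closed under
the derivation. -/
def diffIdeal (S : Set (DiffPoly K)) : Ideal (DiffPoly K) :=
  sInf {I : Ideal (DiffPoly K) | S ⊆ (I : Set (DiffPoly K)) ∧ ∀ P ∈ I, totalDeriv P ∈ I}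

/-- The value `P(y)`: the variable `X j` is replaced by the `j`-th derivative of `y`. -/
def evalAt (y : K⟦X⟧) (P : DiffPoly K) : K⟦X⟧ :=
  MvPolynomial.eval (fun j : ℕ => (PowerSeries.derivative K)^[j] y) P

/-- The set `Sol(S)` of formal power series solutions of a system `S`. -/
def Sol (S : Set (DiffPoly K)) : Set K⟦X⟧ :=
  {y | ∀ P ∈ S, evalAt y P = 0}

end Classical

/-! ### Boolean power series, i.e. the semiring `(2^ℕ, ∪, +)` -/

/-- The semiring `𝔹⟦t⟧ ≅ 2^ℕ` of Boolean formal power series: sum is the union of sets, product is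
the Minkowski sum of subsets of `ℕ` (whence `Multiplicative`). -/
abbrev BoolSeries : Type := SetSemiring (Multiplicative ℕ)

namespace BoolSeries

/-- The Boolean power series `∑_{i ∈ A} tⁱ`. -/
def ofSet (A : Set ℕ) : BoolSeries :=
  Set.up {m : Multiplicative ℕ | Multiplicative.toAdd m ∈ A}

/-- The set of exponents of a Boolean power series. -/
def toSet (w : BoolSeries) : Set ℕ :=
  {i : ℕ | Multiplicative.ofAdd i ∈ SetSemiring.down w}

/-- The derivative of a Boolean power series: shift the exponents down by one. -/
def deriv (w : BoolSeries) : BoolSeries :=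
  ofSet {i : ℕ | i + 1 ∈ toSet w}

/-- The Newton polyhedron: the convex hull of `{i + j : i ∈ w, j ∈ ℕ}`. -/
def newton (w : BoolSeries) : Set ℝ :=
  convexHull ℝ {x : ℝ | ∃ i ∈ toSet w, ∃ j : ℕ, x = (i : ℝ) + (j : ℝ)}

theorem newton_add (v w : BoolSeries) :
    newton (v + w) = convexHull ℝ (newton v ∪ newton w) := by
  unfold newton
  rw [convexHull_convexHull_union_left, convexHull_convexHull_union_right]
  congr 1
  ext x
  simp only [Set.mem_union, Set.mem_ofPred_eq, toSet, SetSemiring.down_add]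
  grind

open scoped Pointwise in
theorem newton_mul (v w : BoolSeries) : newton (v * w) = newton v + newton w := by
  unfold newton
  rw [← convexHull_add]
  congr 1
  ext x
  simp only [Set.mem_add, Set.mem_ofPred_eq, toSet, SetSemiring.down_mul, Set.mem_mul]
  constructor
  · rintro ⟨i, ⟨p, hp, q, hq, hpq⟩, j, rfl⟩
    refine ⟨_, ⟨Multiplicative.toAdd p, hp, 0, rfl⟩, _,
      ⟨Multiplicative.toAdd q, hq, j, rfl⟩, ?_⟩
    have h : Multiplicative.toAdd p + Multiplicative.toAdd q = i := by
      rw [← toAdd_mul, hpq, toAdd_ofAdd]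
    rw [← h]
    push_cast
    ring
  · rintro ⟨_, ⟨i, hi, j, rfl⟩, _, ⟨i', hi', j', rfl⟩, rfl⟩
    refine ⟨i + i', ⟨_, hi, _, hi', (ofAdd_add i i').symm⟩, j + j', ?_⟩
    push_cast
    ring

/-- The semiring congruence on `𝔹⟦t⟧` of pairs with equal Newton polyhedra. -/
def newtonCon : RingCon BoolSeries where
  toSetoid := Setoid.ker newton
  add' {a b c d} h₁ h₂ := by
    have h₁ : newton a = newton b := h₁
    have h₂ : newton c = newton d := h₂
    change newton (a + c) = newton (b + d)
    rw [newton_add, newton_add, h₁, h₂]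
  mul' {a b c d} h₁ h₂ := by
    have h₁ : newton a = newton b := h₁
    have h₂ : newton c = newton d := h₂
    change newton (a * c) = newton (b * d)
    rw [newton_mul, newton_mul, h₁, h₂]

end BoolSeries

/-- The semiring `V𝔹[t] = 𝔹⟦t⟧ / New` of vertex polynomials. -/
abbrev VertexPoly : Type := BoolSeries.newtonCon.Quotient

/-- The quotient homomorphism `V : 𝔹⟦t⟧ → V𝔹[t]`. -/
def vertex : BoolSeries →+* VertexPoly := BoolSeries.newtonCon.mk'

/-- A finite sum `⨁_{i ∈ s} f i` in `V𝔹[t]` vanishes tropically if omitting any one summand does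
not change it. (A sum with a single summand vanishes iff that summand is `0`.) -/
def TropVanishes {ι : Type*} [DecidableEq ι] (s : Finset ι) (f : ι → VertexPoly) : Prop :=
  ∀ i ∈ s, ∑ j ∈ s, f j = ∑ j ∈ s.erase i, f j

/-! ### Tropical differential polynomials -/

/-- The semiring `𝔹⟦t⟧[x₀, x₁, x₂, …]` of tropical ordinary differential polynomials. -/
abbrev TropDiffPoly : Type := MvPolynomial ℕ BoolSeries

/-- The value at `w` of the differential monomial `∏_j x_j ^ (M j)`. -/
def monomialEval (w : BoolSeries) (M : ℕ →₀ ℕ) : BoolSeries :=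
  M.prod fun j e => (BoolSeries.deriv^[j] w) ^ e

open scoped Classical in
/-- `w` is a solution of `p = ∑_M a_M E_M` if `⨁_M V(a_M E_M(w))` vanishes tropically. -/
def IsTropSol (p : TropDiffPoly) (w : BoolSeries) : Prop :=
  TropVanishes p.support fun M => vertex (MvPolynomial.coeff M p * monomialEval w M)

/-- The set `Sol(U)` of common solutions of a system `U` of tropical differential polynomials. -/
def TropSol (U : Set TropDiffPoly) : Set BoolSeries :=
  {w | ∀ p ∈ U, IsTropSol p w}

section Tropicalization

variable {K : Type*} [Field K]

/-- The support map `K⟦t⟧ → 𝔹⟦t⟧ ≅ 2^ℕ`. -/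
def supp (y : K⟦X⟧) : BoolSeries :=
  BoolSeries.ofSet {i : ℕ | PowerSeries.coeff i y ≠ 0}

/-- `trop(∑_M a_M E_M) = ∑_M supp(a_M) E_M`. -/
def trop (P : DiffPoly K) : TropDiffPoly :=
  ∑ M ∈ P.support, MvPolynomial.monomial M (supp (MvPolynomial.coeff M P))

end Tropicalization

/-! ### The data of the example -/

section Example

variable {K : Type*} [Field K]

/-- The linear differential polynomial `x'' + γ x' + β x`. -/
def linearODE (γ β : K⟦X⟧) : DiffPoly K :=
  MvPolynomial.X 2 + MvPolynomial.C γ * MvPolynomial.X 1 + MvPolynomial.C β * MvPolynomial.X 0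

/-- `a₀ = 0`, `a₁ = 1`, and `a₂, a₃, …` is an enumeration, possibly with repetitions, of the
nonzero elements of `K`. -/
structure IsEnumeration (a : ℕ → K) : Prop where
  zero : a 0 = 0
  one : a 1 = 1
  tail : a '' {i : ℕ | 2 ≤ i} = {x : K | x ≠ 0}

/-- `φ₁ = 1 + ∑_{i ≥ 2} tⁱ`. -/
def phi₁ (K : Type*) [Field K] : K⟦X⟧ :=
  1 + PowerSeries.mk fun i => if 2 ≤ i then (1 : K) else 0

/-- `φ₂ = t + ∑_{i ≥ 2} aᵢ tⁱ`. -/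
def phi₂ (a : ℕ → K) : K⟦X⟧ :=
  PowerSeries.X + PowerSeries.mk fun i => if 2 ≤ i then a i else 0

/-- The recurrence equations for the coefficients `cᵢ` of `γ` and `bᵢ` of `β`; they determine all
of them, starting with `c₀ = -2 a₂` and `b₀ = -2`. -/
def IsRecurrence (a : ℕ → K) (γ β : K⟦X⟧) : Prop :=
  (∀ i : ℕ, PowerSeries.coeff i γ =
    -((((i + 2) * (i + 1) : ℕ) : K) * a (i + 2)
      + ∑ j ∈ Finset.range i, ((i + 1 - j : ℕ) : K) * PowerSeries.coeff j γ * a (i + 1 - j)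
      + ∑ j ∈ Finset.range i, PowerSeries.coeff j β * a (i - j))) ∧
  (∀ i : ℕ, PowerSeries.coeff i β =
    -((((i + 2) * (i + 1) : ℕ) : K)
      + ∑ j ∈ Finset.range i, ((i + 1 - j : ℕ) : K) * PowerSeries.coeff j γ
      + ∑ j ∈ Finset.range (i - 1), PowerSeries.coeff j β))

end Example

end TropDiff

end

namespace TropDiff

open PowerSeries

/-! ### Evaluation at a series commutes with the derivation -/

section Evaluation

variable {K : Type*} [Field K]

/-! The series `φ₁`, `φ₂` have initial data (1, 0) and (0, 1), so their Wronskian is a unit and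
Cramer's rule yields exactly one pair `γ`, `β` (`exists_linearODE`, `linearODE_unique`). Comparing
coefficients turns the equations for `φ₁` and `φ₂` into the recurrences for `β` and `γ`. In
characteristic zero the coefficients of degree 0 and 1 determine a solution, so the solutions are
the combinations `c φ₁ + d φ₂`, with coefficients `c`, `d`, and `c + d aᵢ` for `i ≥ 2`.

If `c` and `d` are nonzero, then `-c/d` is some `aᵢ`, so no solution has full support. But the first
`n` coefficients exclude only finitely many values of `c` when `d = 1`, so some solution has all of
them nonzero. This is enough for `ℕ` to be a tropical solution (`univ_mem_tropSol`): a differential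
polynomial involves finitely many derivatives. If its lowest power of `t` occurred in the
coefficient of one monomial only, nothing could cancel that term at such a solution. -/

theorem coeff_sum_monomial_derivative (P : DiffPoly K) (N : ℕ →₀ ℕ) :
    MvPolynomial.coeff N (∑ M ∈ P.support,
      MvPolynomial.monomial M (PowerSeries.derivative K (MvPolynomial.coeff M P))) =
      PowerSeries.derivative K (MvPolynomial.coeff N P) := by
  classical
  rw [MvPolynomial.coeff_sum]
  simp only [MvPolynomial.coeff_monomial, Finset.sum_ite_eq', MvPolynomial.mem_support_iff]
  split_ifs with h
  · rfl
  · rw [not_not] at h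
    rw [h, map_zero]

theorem totalDeriv_add (P Q : DiffPoly K) :
    totalDeriv (P + Q) = totalDeriv P + totalDeriv Q := by
  ext1 N
  rw [totalDeriv, totalDeriv, totalDeriv, map_add (MvPolynomial.mkDerivation _ _)]
  rw [MvPolynomial.coeff_add, MvPolynomial.coeff_add, MvPolynomial.coeff_add,
    MvPolynomial.coeff_add, MvPolynomial.coeff_add, coeff_sum_monomial_derivative,
    coeff_sum_monomial_derivative, coeff_sum_monomial_derivative, MvPolynomial.coeff_add,
    map_add (PowerSeries.derivative K)]
  ring

theorem totalDeriv_C (c : K⟦X⟧) :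
    totalDeriv (MvPolynomial.C c : DiffPoly K) =
      MvPolynomial.C (PowerSeries.derivative K c) := by
  classical
  ext1 N
  rw [totalDeriv, MvPolynomial.coeff_add, coeff_sum_monomial_derivative,
    MvPolynomial.derivation_C, MvPolynomial.coeff_zero, add_zero, MvPolynomial.coeff_C,
    MvPolynomial.coeff_C]
  split_ifs <;> simp

/-- Multiplication by a variable only shifts exponents, so it commutes with differentiating the
coefficients. This case of the Leibniz rule suffices for induction on polynomials. -/
theorem totalDeriv_mul_X (P : DiffPoly K) (n : ℕ) :
    totalDeriv (P * MvPolynomial.X n) =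
      totalDeriv P * MvPolynomial.X n + P * MvPolynomial.X (n + 1) := by
  classical
  have h : (∑ M ∈ (P * MvPolynomial.X n).support, MvPolynomial.monomial M
        (PowerSeries.derivative K (MvPolynomial.coeff M (P * MvPolynomial.X n)))) =
      (∑ M ∈ P.support, MvPolynomial.monomial M
        (PowerSeries.derivative K (MvPolynomial.coeff M P))) * MvPolynomial.X n := by
    ext1 N
    rw [coeff_sum_monomial_derivative, MvPolynomial.coeff_mul_X', MvPolynomial.coeff_mul_X',
      coeff_sum_monomial_derivative]
    split_ifs <;> simp
  unfold totalDeriv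
  rw [h, Derivation.leibniz, MvPolynomial.mkDerivation_X, smul_eq_mul, smul_eq_mul]
  ring

/-- Consequently the kernel of evaluation at `y` is an ideal closed under the derivation. -/
theorem evalAt_totalDeriv (y : K⟦X⟧) (P : DiffPoly K) :
    evalAt y (totalDeriv P) = PowerSeries.derivative K (evalAt y P) := by
  induction P using MvPolynomial.induction_on with
  | C c => simp [totalDeriv_C, evalAt]
  | add P Q hP hQ =>
    rw [totalDeriv_add]
    simp only [evalAt, map_add] at hP hQ ⊢
    rw [hP, hQ]
  | mul_X P n hP =>
    rw [totalDeriv_mul_X]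
    simp only [evalAt, map_add, map_mul, MvPolynomial.eval_X, Derivation.leibniz,
      smul_eq_mul, Function.iterate_succ_apply'] at hP ⊢
    rw [hP]
    ring

/-- A solution of a system annihilates the differential ideal generated by it. -/
theorem evalAt_eq_zero_of_mem_diffIdeal {S : Set (DiffPoly K)} {y : K⟦X⟧} (hy : y ∈ Sol S)
    {P : DiffPoly K} (hP : P ∈ diffIdeal S) : evalAt y P = 0 := by
  let I : Ideal (DiffPoly K) :=
    RingHom.ker (MvPolynomial.eval (fun j : ℕ => (PowerSeries.derivative K)^[j] y))
  have hmem : ∀ Q : DiffPoly K, Q ∈ I ↔ evalAt y Q = 0 := fun Q => RingHom.mem_ker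
  have hI : diffIdeal S ≤ I := by
    refine sInf_le ⟨fun Q hQ => (hmem Q).2 (hy Q hQ), fun Q hQ => ?_⟩
    rw [hmem] at hQ ⊢
    rw [evalAt_totalDeriv, hQ, map_zero]
  exact (hmem P).1 (hI hP)

theorem mem_Sol_linearODE {γ β y : K⟦X⟧} :
    y ∈ Sol {linearODE γ β} ↔
      PowerSeries.derivative K (PowerSeries.derivative K y) +
        γ * PowerSeries.derivative K y + β * y = 0 := by
  simp [Sol, evalAt, linearODE]

theorem constantCoeff_iterate_derivative (y : K⟦X⟧) (j : ℕ) :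
    constantCoeff ((PowerSeries.derivative K)^[j] y) = (j.factorial : K) * coeff j y := by
  induction j generalizing y with
  | zero => simp
  | succ j ih =>
    rw [Function.iterate_succ_apply, ih, coeff_derivative, Nat.factorial_succ]
    push_cast
    ring

end Evaluation

/-! ### Vertex polynomials of sets of natural numbers -/

namespace BoolSeries

theorem toSet_ofSet (A : Set ℕ) : toSet (ofSet A) = A := rfl

theorem ofSet_add (A B : Set ℕ) : ofSet A + ofSet B = ofSet (A ∪ B) := rfl

theorem zero_eq_ofSet : (0 : BoolSeries) = ofSet ∅ := rfl

theorem mem_toSet_mul {v w : BoolSeries} {n : ℕ} :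
    n ∈ toSet (v * w) ↔ ∃ i ∈ toSet v, ∃ j ∈ toSet w, i + j = n := by
  simp only [toSet, SetSemiring.down_mul, Set.mem_mul, Set.mem_ofPred_eq]
  rfl

/-- Adding `ℕ` to a nonempty set of exponents gives everything from its minimum on, so its class
depends on the minimum alone. -/
theorem vertex_eq_of_isLeast {w : BoolSeries} {v : ℕ} (h : IsLeast (toSet w) v) :
    vertex w = vertex (ofSet {v}) := by
  refine (RingCon.eq newtonCon).2 ?_
  change newton w = newton (ofSet {v})
  unfold newton
  congr 1
  ext x
  simp only [toSet_ofSet, Set.mem_ofPred_eq]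
  constructor
  · rintro ⟨i, hi, j, rfl⟩
    refine ⟨v, rfl, i - v + j, ?_⟩
    have := h.2 hi
    push_cast [Nat.cast_sub this]
    ring
  · rintro ⟨i, rfl, j, rfl⟩
    exact ⟨_, h.1, j, rfl⟩

theorem vertex_singleton_add {w : BoolSeries} {v : ℕ} (h : ∀ i ∈ toSet w, v ≤ i) :
    vertex (ofSet {v}) + vertex w = vertex (ofSet {v}) := by
  rw [← map_add]
  refine vertex_eq_of_isLeast ⟨Or.inl rfl, ?_⟩
  rintro i (hi | hi)
  · exact (show i = v from hi).ge
  · exact h i hi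

theorem deriv_ofSet_univ : deriv (ofSet Set.univ) = ofSet Set.univ := rfl

theorem iterate_deriv_ofSet_univ (j : ℕ) : deriv^[j] (ofSet Set.univ) = ofSet Set.univ :=
  Function.iterate_fixed deriv_ofSet_univ j

theorem zero_mem_toSet_one : 0 ∈ toSet 1 := rfl

theorem zero_mem_toSet_mul {v w : BoolSeries} (hv : 0 ∈ toSet v) (hw : 0 ∈ toSet w) :
    0 ∈ toSet (v * w) :=
  mem_toSet_mul.2 ⟨0, hv, 0, hw, rfl⟩

theorem zero_mem_toSet_pow {w : BoolSeries} (hw : 0 ∈ toSet w) (n : ℕ) :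
    0 ∈ toSet (w ^ n) := by
  induction n with
  | zero => rw [pow_zero]; exact zero_mem_toSet_one
  | succ n ih => rw [pow_succ]; exact zero_mem_toSet_mul ih hw

/-- All derivatives of `ℕ` equal `ℕ`, so evaluating a monomial there does not raise the least
exponent of its coefficient. -/
theorem zero_mem_toSet_monomialEval_univ (M : ℕ →₀ ℕ) :
    0 ∈ toSet (monomialEval (ofSet Set.univ) M) := by
  refine Finset.prod_induction _ (fun w => 0 ∈ toSet w)
    (fun _ _ => zero_mem_toSet_mul) zero_mem_toSet_one fun j _ => zero_mem_toSet_pow ?_ _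
  rw [iterate_deriv_ofSet_univ]
  trivial

end BoolSeries

open BoolSeries

theorem sum_eq_of_absorbing {ι M : Type*} [AddCommMonoid M] {s : Finset ι} {f : ι → M}
    {e : M} {i : ι} (hi : i ∈ s) (hfi : f i = e) (h : ∀ j ∈ s, e + f j = e) :
    ∑ j ∈ s, f j = e := by
  classical
  have key : ∀ u ⊆ s, e + ∑ j ∈ u, f j = e := by
    intro u
    induction u using Finset.induction_on with
    | empty => simp
    | insert j u hj ih =>
      intro hu
      rw [Finset.sum_insert hj, ← add_assoc, h j (hu (Finset.mem_insert_self j u))]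
      exact ih fun l hl => hu (Finset.mem_insert_of_mem hl)
  rw [← Finset.add_sum_erase s f hi, hfi]
  exact key _ (Finset.erase_subset i s)

/-- A sum vanishes tropically if two of its summands absorb all the others. -/
theorem tropVanishes_of_two {ι : Type*} [DecidableEq ι] {s : Finset ι} {f : ι → VertexPoly}
    {e : VertexPoly} {i₁ i₂ : ι} (h₁ : i₁ ∈ s) (h₂ : i₂ ∈ s) (hne : i₁ ≠ i₂)
    (hf₁ : f i₁ = e) (hf₂ : f i₂ = e) (h : ∀ j ∈ s, e + f j = e) : TropVanishes s f := by
  intro i _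
  have h' : ∀ j ∈ s.erase i, e + f j = e := fun j hj => h j (Finset.mem_of_mem_erase hj)
  rw [sum_eq_of_absorbing h₁ hf₁ h]
  by_cases hi : i₁ = i
  · exact (sum_eq_of_absorbing (Finset.mem_erase.2 ⟨hi ▸ hne.symm, h₂⟩) hf₂ h').symm
  · exact (sum_eq_of_absorbing (Finset.mem_erase.2 ⟨hi, h₁⟩) hf₁ h').symm

/-! ### Tropical solutions from solutions with large support -/

section Tropical

variable {K : Type*} [Field K]

theorem toSet_supp (y : K⟦X⟧) : toSet (supp y) = {i | coeff i y ≠ 0} := rfl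

theorem supp_eq_zero {y : K⟦X⟧} : supp y = 0 ↔ y = 0 := by
  constructor
  · intro h
    ext i
    by_contra hi
    have : i ∈ toSet (0 : BoolSeries) := h ▸ (show i ∈ toSet (supp y) from hi)
    exact this
  · rintro rfl
    rw [zero_eq_ofSet, supp]
    simp

theorem coeff_trop (P : DiffPoly K) (N : ℕ →₀ ℕ) :
    MvPolynomial.coeff N (trop P) = supp (MvPolynomial.coeff N P) := by
  classical
  rw [trop, MvPolynomial.coeff_sum]
  simp only [MvPolynomial.coeff_monomial, Finset.sum_ite_eq', MvPolynomial.mem_support_iff]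
  split_ifs with h
  · rfl
  · rw [not_not] at h
    rw [h, supp_eq_zero.2 rfl]

theorem support_trop (P : DiffPoly K) : (trop P).support = P.support := by
  ext M
  rw [MvPolynomial.mem_support_iff, MvPolynomial.mem_support_iff, coeff_trop, Ne, Ne,
    supp_eq_zero]

/-- If `v` is the least exponent in the coefficients of `P`, then it occurs in two coefficients,
provided that `P` has zeros whose coefficients do not vanish up to any given order. -/
theorem exists_ne_coeff_ne_zero [CharZero K] {P : DiffPoly K}
    (hP : ∀ n : ℕ, ∃ y : K⟦X⟧, evalAt y P = 0 ∧ ∀ i < n, coeff i y ≠ 0)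
    {v : ℕ} (hv : ∀ M, ∀ i < v, coeff i (MvPolynomial.coeff M P) = 0)
    {M : ℕ →₀ ℕ} (hM : coeff v (MvPolynomial.coeff M P) ≠ 0) :
    ∃ N ≠ M, coeff v (MvPolynomial.coeff N P) ≠ 0 := by
  by_contra! hN
  -- The bound exceeds the order of every derivative occurring in `M`.
  obtain ⟨y, hy, hyi⟩ := hP (M.support.sup id + 1)
  -- All coefficients of `P` start at degree `v` or later, so only constant terms of the other
  -- factor contribute in degree `v`.
  have hlow : ∀ (N : ℕ →₀ ℕ) (z : K⟦X⟧),
      coeff v (MvPolynomial.coeff N P * z) =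
        coeff v (MvPolynomial.coeff N P) * constantCoeff z := by
    intro N z
    rw [coeff_mul, Finset.sum_eq_single (v, 0)]
    · simp
    · rintro ⟨i, j⟩ hij hne
      rw [Finset.HasAntidiagonal.mem_antidiagonal] at hij
      have hi : i < v := by
        rcases Nat.lt_or_ge i v with h | h
        · exact h
        · exact absurd (Prod.ext (by simp at hij ⊢; omega) (by simp at hij ⊢; omega)) hne
      simp [hv N i hi]
    · simp
  have h0 := congrArg (coeff v) hy
  rw [evalAt, MvPolynomial.eval_eq, map_sum, Finset.sum_eq_single M] at h0
  -- Only `M` contributes, so the constant term of some `j`-th derivative in `M` vanishes. That term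
  -- is `j!` times the `j`-th coefficient of `y`, which is nonzero.
  · rw [hlow, map_zero, mul_eq_zero, or_iff_right hM, map_prod, Finset.prod_eq_zero_iff] at h0
    obtain ⟨j, hj, h0⟩ := h0
    rw [map_pow] at h0
    have h0 := eq_zero_of_pow_eq_zero h0
    rw [constantCoeff_iterate_derivative, mul_eq_zero] at h0
    rcases h0 with h0 | h0
    · exact Nat.factorial_ne_zero j (by exact_mod_cast h0)
    · exact hyi j (Nat.lt_succ_of_le (Finset.le_sup (f := id) hj)) h0
  · intro N _ hNM
    rw [hlow, hN N hNM, zero_mul]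
  · intro hM'
    rw [MvPolynomial.notMem_support_iff] at hM'
    simp [hM'] at hM

/-- If a system has solutions whose coefficients do not vanish up to any given order, then `ℕ` is
a solution of the tropicalization of its differential ideal. -/
theorem univ_mem_tropSol [CharZero K] {S : Set (DiffPoly K)}
    (hS : ∀ n : ℕ, ∃ y ∈ Sol S, ∀ i < n, coeff i y ≠ 0) :
    ofSet Set.univ ∈ TropSol (trop '' (diffIdeal S : Set (DiffPoly K))) := by
  classical
  rintro _ ⟨P, hP, rfl⟩
  unfold IsTropSol
  rcases eq_or_ne P 0 with rfl | hP0
  · intro i hi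
    rw [support_trop] at hi
    simp at hi
  have hex : ∃ v : ℕ, ∃ M, coeff v (MvPolynomial.coeff M P) ≠ 0 := by
    by_contra! h
    refine hP0 (MvPolynomial.ext _ _ fun M => PowerSeries.ext fun v => ?_)
    rw [h v M]
    simp
  obtain ⟨M₁, hM₁⟩ := Nat.find_spec hex
  have hv : ∀ M, ∀ i < Nat.find hex, coeff i (MvPolynomial.coeff M P) = 0 := by
    intro M i hi
    by_contra h
    exact Nat.find_min hex hi ⟨M, h⟩
  generalize Nat.find hex = v at hM₁ hv
  obtain ⟨M₂, hne, hM₂⟩ := exists_ne_coeff_ne_zero (fun n => by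
    obtain ⟨y, hy, h⟩ := hS n
    exact ⟨y, evalAt_eq_zero_of_mem_diffIdeal hy hP, h⟩) hv hM₁
  have hle : ∀ M, ∀ i ∈ toSet (MvPolynomial.coeff M (trop P) *
      monomialEval (ofSet Set.univ) M), v ≤ i := by
    intro M i hi
    obtain ⟨p, hp, q, -, rfl⟩ := mem_toSet_mul.1 hi
    rw [coeff_trop, toSet_supp] at hp
    by_contra! h
    exact hp (hv M p (by omega))
  have hvertex : ∀ M, coeff v (MvPolynomial.coeff M P) ≠ 0 →
      vertex (MvPolynomial.coeff M (trop P) * monomialEval (ofSet Set.univ) M) =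
        vertex (ofSet {v}) := by
    intro M hM
    refine vertex_eq_of_isLeast ⟨mem_toSet_mul.2
      ⟨v, ?_, 0, zero_mem_toSet_monomialEval_univ M, rfl⟩, hle M⟩
    rw [coeff_trop]
    exact hM
  have hmem : ∀ M, coeff v (MvPolynomial.coeff M P) ≠ 0 → M ∈ (trop P).support := by
    intro M hM
    rw [support_trop, MvPolynomial.mem_support_iff]
    intro h
    simp [h] at hM
  exact tropVanishes_of_two (hmem _ hM₁) (hmem _ hM₂) hne.symm (hvertex _ hM₁)
    (hvertex _ hM₂) fun M _ => vertex_singleton_add (hle M)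

end Tropical

/-! ### Second order linear equations -/

section LinearODE

variable {K : Type*} [Field K]

theorem Sol_linearODE_add {γ β y z : K⟦X⟧} (hy : y ∈ Sol {linearODE γ β})
    (hz : z ∈ Sol {linearODE γ β}) (c d : K) : c • y + d • z ∈ Sol {linearODE γ β} := by
  rw [mem_Sol_linearODE] at *
  simp only [map_add, Derivation.map_smul]
  simp only [smul_eq_C_mul]
  linear_combination (PowerSeries.C c) * hy + (PowerSeries.C d) * hz

/-- In degree `n` the equation expresses `(n + 2)(n + 1)` times coefficient `n + 2` through earlier
coefficients. -/
theorem eq_zero_of_mem_Sol_linearODE [CharZero K] {γ β y : K⟦X⟧}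
    (hy : y ∈ Sol {linearODE γ β}) (h0 : coeff 0 y = 0) (h1 : coeff 1 y = 0) : y = 0 := by
  rw [mem_Sol_linearODE] at hy
  ext n
  induction n using Nat.strong_induction_on with
  | _ n ih =>
    match n with
    | 0 => simpa using h0
    | 1 => simpa using h1
    | n + 2 =>
      have h := congrArg (coeff n) hy
      have hγ : coeff n (γ * PowerSeries.derivative K y) = 0 := by
        rw [coeff_mul]
        refine Finset.sum_eq_zero fun p hp => ?_
        rw [Finset.HasAntidiagonal.mem_antidiagonal] at hp
        rw [coeff_derivative, ih (p.2 + 1) (by omega)]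
        simp
      have hβ : coeff n (β * y) = 0 := by
        rw [coeff_mul]
        refine Finset.sum_eq_zero fun p hp => ?_
        rw [Finset.HasAntidiagonal.mem_antidiagonal] at hp
        rw [ih p.2 (by omega)]
        simp
      rw [map_add, map_add, hγ, hβ, add_zero, add_zero, coeff_derivative, coeff_derivative,
        map_zero] at h
      rw [map_zero]
      have h' := (mul_eq_zero.1 h).resolve_right (Nat.cast_add_one_ne_zero n)
      exact (mul_eq_zero.1 h').resolve_right (Nat.cast_add_one_ne_zero (n + 1))

theorem Sol_linearODE_eq_span [CharZero K] {γ β y z : K⟦X⟧} (hy : y ∈ Sol {linearODE γ β})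
    (hz : z ∈ Sol {linearODE γ β}) (hy0 : coeff 0 y = 1) (hy1 : coeff 1 y = 0)
    (hz0 : coeff 0 z = 0) (hz1 : coeff 1 z = 1) :
    Sol {linearODE γ β} = (Submodule.span K {y, z} : Set K⟦X⟧) := by
  ext w
  rw [SetLike.mem_coe, Submodule.mem_span_pair]
  constructor
  · intro hw
    refine ⟨coeff 0 w, coeff 1 w, ?_⟩
    have h := Sol_linearODE_add hw (Sol_linearODE_add hy hz (coeff 0 w) (coeff 1 w)) 1 (-1)
    have h' := eq_zero_of_mem_Sol_linearODE h
      (by rw [map_add, map_smul, map_smul, map_add, map_smul, map_smul, hy0, hz0]; simp)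
      (by rw [map_add, map_smul, map_smul, map_add, map_smul, map_smul, hy1, hz1]; simp)
    rw [one_smul, neg_one_smul, ← sub_eq_add_neg, sub_eq_zero] at h'
    exact h'.symm
  · rintro ⟨c, d, rfl⟩
    exact Sol_linearODE_add hy hz c d

theorem wronskian_ne_zero {y z : K⟦X⟧} (hy0 : coeff 0 y = 1) (hz0 : coeff 0 z = 0)
    (hz1 : coeff 1 z = 1) :
    constantCoeff (y * PowerSeries.derivative K z - PowerSeries.derivative K y * z) ≠ 0 := by
  rw [map_sub, map_mul, map_mul]
  simp only [← coeff_zero_eq_constantCoeff_apply, coeff_derivative, hy0, hz0]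
  simp [hz1]

/-- Cramer's rule for the two linear conditions on `γ` and `β`; the determinant `W` is invertible.
-/
theorem exists_linearODE {y z : K⟦X⟧} (hy0 : coeff 0 y = 1) (hz0 : coeff 0 z = 0)
    (hz1 : coeff 1 z = 1) :
    ∃ γ β : K⟦X⟧, y ∈ Sol {linearODE γ β} ∧ z ∈ Sol {linearODE γ β} := by
  have hW := PowerSeries.mul_inv_cancel _ (wronskian_ne_zero hy0 hz0 hz1)
  set W := y * PowerSeries.derivative K z - PowerSeries.derivative K y * z with hWdef
  set y' := PowerSeries.derivative K y
  set z' := PowerSeries.derivative K z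
  set y'' := PowerSeries.derivative K y' with hy''
  set z'' := PowerSeries.derivative K z' with hz''
  refine ⟨(y'' * z - z'' * y) * W⁻¹, (y' * z'' - y'' * z') * W⁻¹, ?_, ?_⟩
  · rw [mem_Sol_linearODE]
    linear_combination (-y'') * hW + y'' * W⁻¹ * hWdef
  · rw [mem_Sol_linearODE]
    linear_combination (-z'') * hW + z'' * W⁻¹ * hWdef

/-- The differences `γ' - γ` and `β' - β` solve a homogeneous 2 × 2 system whose determinant is, up
to sign, the nonzero Wronskian. -/
theorem linearODE_unique {y z γ β γ' β' : K⟦X⟧} (hy0 : coeff 0 y = 1) (hz0 : coeff 0 z = 0)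
    (hz1 : coeff 1 z = 1) (hy : y ∈ Sol {linearODE γ β}) (hz : z ∈ Sol {linearODE γ β})
    (hy' : y ∈ Sol {linearODE γ' β'}) (hz' : z ∈ Sol {linearODE γ' β'}) :
    γ' = γ ∧ β' = β := by
  have hW : y * PowerSeries.derivative K z - PowerSeries.derivative K y * z ≠ 0 := fun h =>
    wronskian_ne_zero hy0 hz0 hz1 (by rw [h, map_zero])
  rw [mem_Sol_linearODE] at hy hz hy' hz'
  constructor <;> refine mul_right_cancel₀ hW ?_
  · linear_combination y * (hz' - hz) - z * (hy' - hy)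
  · linear_combination
      PowerSeries.derivative K z * (hy' - hy) - PowerSeries.derivative K y * (hz' - hz)

end LinearODE

/-! ### The example -/

section Example

variable {K : Type*} [Field K]

theorem coeff_phi₁ (n : ℕ) : coeff n (phi₁ K) = if n = 1 then 0 else 1 := by
  rw [phi₁, map_add, coeff_one, coeff_mk]
  rcases n with _ | _ | n <;> simp

theorem coeff_phi₂ {a : ℕ → K} (h0 : a 0 = 0) (h1 : a 1 = 1) (n : ℕ) :
    coeff n (phi₂ a) = a n := by
  rw [phi₂, map_add, coeff_X, coeff_mk]
  rcases n with _ | _ | n <;> simp [h0, h1]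

theorem coeff_linearODE (γ β y : K⟦X⟧) (n : ℕ) :
    coeff n (PowerSeries.derivative K (PowerSeries.derivative K y) +
        γ * PowerSeries.derivative K y + β * y) =
      (((n + 2) * (n + 1) : ℕ) : K) * coeff (n + 2) y +
        ∑ j ∈ Finset.range (n + 1), ((n + 1 - j : ℕ) : K) * coeff j γ * coeff (n + 1 - j) y +
        ∑ j ∈ Finset.range (n + 1), coeff j β * coeff (n - j) y := by
  rw [map_add, map_add, coeff_derivative, coeff_derivative, coeff_mul, coeff_mul,
    Finset.Nat.sum_antidiagonal_eq_sum_range_succ (fun i j => coeff i γ * coeff j _),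
    Finset.Nat.sum_antidiagonal_eq_sum_range_succ (fun i j => coeff i β * coeff j _)]
  congr 2
  · push_cast
    ring
  · refine Finset.sum_congr rfl fun j hj => ?_
    rw [Finset.mem_range] at hj
    rw [coeff_derivative, show n + 1 - j = n - j + 1 by omega]
    push_cast
    ring

/-- The missing linear term of `φ₁` removes coefficient `i` of `γ` and coefficient `i - 1` of `β`
from the equation in degree `i`, which can then be solved for coefficient `i` of `β`. -/
theorem phi₁_mem_Sol_iff {γ β : K⟦X⟧} :
    phi₁ K ∈ Sol {linearODE γ β} ↔ ∀ i : ℕ, coeff i β =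
      -((((i + 2) * (i + 1) : ℕ) : K)
        + ∑ j ∈ Finset.range i, ((i + 1 - j : ℕ) : K) * coeff j γ
        + ∑ j ∈ Finset.range (i - 1), coeff j β) := by
  rw [mem_Sol_linearODE, PowerSeries.ext_iff]
  refine forall_congr' fun i => ?_
  have hγ : ∑ j ∈ Finset.range (i + 1),
      ((i + 1 - j : ℕ) : K) * coeff j γ * coeff (i + 1 - j) (phi₁ K) =
        ∑ j ∈ Finset.range i, ((i + 1 - j : ℕ) : K) * coeff j γ := by
    rw [Finset.sum_range_succ, coeff_phi₁, if_pos (by omega), mul_zero, add_zero]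
    refine Finset.sum_congr rfl fun j hj => ?_
    rw [Finset.mem_range] at hj
    rw [coeff_phi₁, if_neg (by omega), mul_one]
  have hβ : ∑ j ∈ Finset.range (i + 1), coeff j β * coeff (i - j) (phi₁ K) =
      ∑ j ∈ Finset.range (i - 1), coeff j β + coeff i β := by
    rw [Finset.sum_range_succ, coeff_phi₁, if_neg (by omega), mul_one]
    congr 1
    rcases i with _ | i
    · simp
    · rw [Finset.sum_range_succ, coeff_phi₁, if_pos (by omega), mul_zero, add_zero,
        Nat.add_sub_cancel]
      refine Finset.sum_congr rfl fun j hj => ?_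
      rw [Finset.mem_range] at hj
      rw [coeff_phi₁, if_neg (by omega), mul_one]
  rw [coeff_linearODE, hγ, hβ, coeff_phi₁, if_neg (by omega), mul_one, map_zero,
    eq_neg_iff_add_eq_zero]
  ring_nf

/-- Since `a 0 = 0` and `a 1 = 1`, the top terms of the two sums leave only coefficient `i` of `γ`,
with factor one. -/
theorem phi₂_mem_Sol_iff {a : ℕ → K} (h0 : a 0 = 0) (h1 : a 1 = 1) {γ β : K⟦X⟧} :
    phi₂ a ∈ Sol {linearODE γ β} ↔ ∀ i : ℕ, coeff i γ =
      -((((i + 2) * (i + 1) : ℕ) : K) * a (i + 2)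
        + ∑ j ∈ Finset.range i, ((i + 1 - j : ℕ) : K) * coeff j γ * a (i + 1 - j)
        + ∑ j ∈ Finset.range i, coeff j β * a (i - j)) := by
  rw [mem_Sol_linearODE, PowerSeries.ext_iff]
  refine forall_congr' fun i => ?_
  rw [coeff_linearODE]
  simp only [coeff_phi₂ h0 h1]
  rw [Finset.sum_range_succ, Finset.sum_range_succ, Nat.sub_self, h0,
    show i + 1 - i = 1 by omega, h1, map_zero, eq_neg_iff_add_eq_zero]
  ring_nf

theorem isRecurrence_iff {a : ℕ → K} (h0 : a 0 = 0) (h1 : a 1 = 1) {γ β : K⟦X⟧} :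
    IsRecurrence a γ β ↔
      phi₁ K ∈ Sol {linearODE γ β} ∧ phi₂ a ∈ Sol {linearODE γ β} := by
  rw [phi₁_mem_Sol_iff, phi₂_mem_Sol_iff h0 h1, and_comm, IsRecurrence]

/-! ### Supports of the combinations of `φ₁` and `φ₂` -/

theorem coeff_combination {a : ℕ → K} (h0 : a 0 = 0) (h1 : a 1 = 1) (c d : K) (n : ℕ) :
    coeff n (c • phi₁ K + d • phi₂ a) = if n = 0 then c else if n = 1 then d else c + d * a n := by
  rw [map_add, map_smul, map_smul, coeff_phi₁, coeff_phi₂ h0 h1]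
  rcases n with _ | _ | n <;> simp [h0, h1]

theorem linearIndependent_phi {a : ℕ → K} (h0 : a 0 = 0) (h1 : a 1 = 1) :
    LinearIndependent K ![phi₁ K, phi₂ a] := by
  rw [LinearIndependent.pair_iff]
  intro c d h
  have hc := congrArg (coeff 0) h
  have hd := congrArg (coeff 1) h
  rw [coeff_combination h0 h1] at hc hd
  exact ⟨by simpa using hc, by simpa using hd⟩

theorem IsEnumeration.ne_zero {a : ℕ → K} (ha : IsEnumeration a) {i : ℕ} (hi : 2 ≤ i) :
    a i ≠ 0 := by
  have h : a i ∈ a '' {i : ℕ | 2 ≤ i} := ⟨i, hi, rfl⟩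
  rw [ha.tail] at h
  exact h

theorem IsEnumeration.exists_eq {a : ℕ → K} (ha : IsEnumeration a) {x : K} (hx : x ≠ 0) :
    ∃ i, 2 ≤ i ∧ a i = x := by
  have h : x ∈ a '' {i : ℕ | 2 ≤ i} := by
    rw [ha.tail]
    exact hx
  exact h

theorem supp_eq_ofSet {y : K⟦X⟧} {A : Set ℕ} (h : ∀ i, coeff i y ≠ 0 ↔ i ∈ A) :
    supp y = ofSet A :=
  congrArg ofSet (Set.ext h)

theorem supp_phi₁ : supp (phi₁ K) = ofSet {1}ᶜ :=
  supp_eq_ofSet fun i => by simp [coeff_phi₁]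

theorem supp_phi₂ {a : ℕ → K} (ha : IsEnumeration a) : supp (phi₂ a) = ofSet {0}ᶜ :=
  supp_eq_ofSet fun i => by
    rw [coeff_phi₂ ha.zero ha.one]
    rcases i with _ | _ | i
    · simp [ha.zero]
    · simp [ha.one]
    · simp [ha.ne_zero (i := i + 1 + 1) (by omega)]

/-- A combination of `φ₁` and `φ₂` with nonzero coefficients has a vanishing coefficient. -/
theorem IsEnumeration.exists_add_mul_eq_zero {a : ℕ → K} (ha : IsEnumeration a) {c d : K}
    (hc : c ≠ 0) (hd : d ≠ 0) : ∃ i, 2 ≤ i ∧ c + d * a i = 0 := by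
  -- The value to be found in the enumeration is `-c / d`.
  obtain ⟨i, hi, hai⟩ := ha.exists_eq (div_ne_zero (neg_ne_zero.2 hc) hd)
  refine ⟨i, hi, ?_⟩
  rw [hai]
  field_simp
  ring

theorem supp_ne_univ_of_mem_span {a : ℕ → K} (ha : IsEnumeration a) {y : K⟦X⟧}
    (hy : y ∈ Submodule.span K {phi₁ K, phi₂ a}) : supp y ≠ ofSet Set.univ := by
  obtain ⟨c, d, rfl⟩ := Submodule.mem_span_pair.1 hy
  intro h
  have h' : ∀ i, coeff i (c • phi₁ K + d • phi₂ a) ≠ 0 := fun i => by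
    have : i ∈ toSet (supp (c • phi₁ K + d • phi₂ a)) := h ▸ Set.mem_univ i
    exact this
  simp only [coeff_combination ha.zero ha.one] at h'
  obtain ⟨i, hi, hz⟩ := ha.exists_add_mul_eq_zero (by simpa using h' 0) (by simpa using h' 1)
  have := h' i
  rw [if_neg (by omega), if_neg (by omega)] at this
  exact this hz

/-- The missing exponent is 0 if `c = 0`, 1 if `d = 0`, and otherwise the index of `-c/d`, unique by
injectivity. -/
theorem exists_supp_eq_compl_singleton {a : ℕ → K} (ha : IsEnumeration a)
    (hinj : Set.InjOn a {i : ℕ | 2 ≤ i}) {y : K⟦X⟧}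
    (hy : y ∈ Submodule.span K {phi₁ K, phi₂ a}) (hy0 : y ≠ 0) :
    ∃ j : ℕ, supp y = ofSet {j}ᶜ := by
  obtain ⟨c, d, rfl⟩ := Submodule.mem_span_pair.1 hy
  by_cases hc : c = 0
  · have hd : d ≠ 0 := by
      rintro rfl
      simp [hc] at hy0
    refine ⟨0, supp_eq_ofSet fun i => ?_⟩
    rw [coeff_combination ha.zero ha.one, Set.mem_compl_singleton_iff]
    split_ifs with h0 h1
    · simp [hc, h0]
    · simp [hd, h0]
    · simp [hc, hd, h0, ha.ne_zero (i := i) (by omega)]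
  by_cases hd : d = 0
  · refine ⟨1, supp_eq_ofSet fun i => ?_⟩
    rw [coeff_combination ha.zero ha.one, Set.mem_compl_singleton_iff]
    split_ifs with h0 h1
    · simp [hc, h0]
    · simp [hd, h1]
    · simp [hc, hd, h1]
  obtain ⟨j, hj, hz⟩ := ha.exists_add_mul_eq_zero hc hd
  refine ⟨j, supp_eq_ofSet fun i => ?_⟩
  rw [coeff_combination ha.zero ha.one, Set.mem_compl_singleton_iff]
  split_ifs with h0 h1
  · exact iff_of_true hc (by omega)
  · exact iff_of_true hd (by omega)
  · refine not_congr ⟨fun h => hinj (show 2 ≤ i by omega) hj ?_, fun h => h ▸ hz⟩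
    exact mul_left_cancel₀ hd (add_left_cancel (h.trans hz.symm))

theorem exists_mem_span_coeff_ne_zero [CharZero K] {a : ℕ → K} (h0 : a 0 = 0) (h1 : a 1 = 1)
    (n : ℕ) : ∃ y ∈ Submodule.span K {phi₁ K, phi₂ a}, ∀ i < n, coeff i y ≠ 0 := by
  classical
  -- With `d = 1`, the coefficients below `n` can vanish only if `c` is 0 or some `-a i`; an
  -- infinite field has another choice.
  obtain ⟨c, hc⟩ := Infinite.exists_notMem_finset
    (insert 0 ((Finset.range n).image fun i => -a i))
  rw [Finset.mem_insert, not_or] at hc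
  refine ⟨c • phi₁ K + (1 : K) • phi₂ a, Submodule.mem_span_pair.2 ⟨c, 1, rfl⟩, fun i hi => ?_⟩
  rw [coeff_combination h0 h1]
  split_ifs with h0 h1
  · exact hc.1
  · exact one_ne_zero
  · intro h
    refine hc.2 (Finset.mem_image.2 ⟨i, Finset.mem_range.2 hi, ?_⟩)
    linear_combination -h

theorem exists_isEnumeration_injOn (K : Type*) [Field K] [CharZero K] [Countable K] :
    ∃ a : ℕ → K, IsEnumeration a ∧ Set.InjOn a {i : ℕ | 2 ≤ i} := by
  have : Infinite {x : K // x ≠ 0} :=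
    (Set.finite_singleton (0 : K)).infinite_compl.to_subtype
  obtain ⟨e⟩ := nonempty_equiv_of_countable (α := ℕ) (β := {x : K // x ≠ 0})
  refine ⟨fun i => if i = 0 then 0 else if i = 1 then 1 else (e (i - 2) : K),
    ⟨by simp, by simp, ?_⟩, ?_⟩
  · ext x
    constructor
    · rintro ⟨i, hi, rfl⟩
      have hi : 2 ≤ i := hi
      simp only [if_neg (show i ≠ 0 by omega), if_neg (show i ≠ 1 by omega)]
      exact (e (i - 2)).2
    · intro hx
      exact ⟨e.symm ⟨x, hx⟩ + 2, Nat.le_add_left 2 _, by simp⟩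
  · intro i hi j hj hij
    have hi : 2 ≤ i := hi
    have hj : 2 ≤ j := hj
    simp only [if_neg (show i ≠ 0 by omega), if_neg (show i ≠ 1 by omega),
      if_neg (show j ≠ 0 by omega), if_neg (show j ≠ 1 by omega)] at hij
    have := e.injective (Subtype.ext hij)
    omega

end Example

end TropDiff

theorem mainTheorem8 (k : Type*) [Field k] [CharZero k] [Countable k] :
    -- enumerations as required exist, even without repetitions
    (∃ a : ℕ → k, TropDiff.IsEnumeration a ∧ Set.InjOn a {i : ℕ | 2 ≤ i}) ∧
    ∀ a : ℕ → k, TropDiff.IsEnumeration a →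
      ∃ γ β : PowerSeries k,
        -- the coefficients are given by the recurrence equations, and these determine them
        TropDiff.IsRecurrence a γ β ∧
        (∀ γ' β' : PowerSeries k, TropDiff.IsRecurrence a γ' β' → γ' = γ ∧ β' = β) ∧
        -- the solution space of `y'' + γ y' + β y = 0` has the basis `φ₁, φ₂`
        TropDiff.Sol {TropDiff.linearODE γ β} =
          (Submodule.span k {TropDiff.phi₁ k, TropDiff.phi₂ a} : Set (PowerSeries k)) ∧
        LinearIndependent k ![TropDiff.phi₁ k, TropDiff.phi₂ a] ∧
        -- and this is the only equation of this form with that solution space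
        (∀ γ' β' : PowerSeries k,
          TropDiff.Sol {TropDiff.linearODE γ' β'} =
            (Submodule.span k {TropDiff.phi₁ k, TropDiff.phi₂ a} : Set (PowerSeries k)) →
          γ' = γ ∧ β' = β) ∧
        -- the supports of `φ₁`, `φ₂` and of the other solutions
        TropDiff.supp (TropDiff.phi₁ k) = TropDiff.BoolSeries.ofSet {1}ᶜ ∧
        TropDiff.supp (TropDiff.phi₂ a) = TropDiff.BoolSeries.ofSet {0}ᶜ ∧
        (Set.InjOn a {i : ℕ | 2 ≤ i} →
          ∀ y ∈ TropDiff.Sol {TropDiff.linearODE γ β}, y ≠ 0 →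
            ∃ j : ℕ, TropDiff.supp y = TropDiff.BoolSeries.ofSet {j}ᶜ) ∧
        -- the union of the supports of `φ₁` and `φ₂` is `ℕ`
        TropDiff.supp (TropDiff.phi₁ k) + TropDiff.supp (TropDiff.phi₂ a) =
          TropDiff.BoolSeries.ofSet Set.univ ∧
        -- `ℕ` is a solution of the tropicalization of the differential ideal of the equation
        TropDiff.BoolSeries.ofSet Set.univ ∈
          TropDiff.TropSol (TropDiff.trop ''
            (TropDiff.diffIdeal {TropDiff.linearODE γ β} : Set (TropDiff.DiffPoly k))) ∧
        -- but `ℕ` is not the support of a solution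
        TropDiff.BoolSeries.ofSet Set.univ ∉
          TropDiff.supp '' TropDiff.Sol {TropDiff.linearODE γ β} ∧
        -- so the equality asserted by the fundamental theorem fails
        TropDiff.supp '' TropDiff.Sol {TropDiff.linearODE γ β} ≠
          TropDiff.TropSol (TropDiff.trop ''
            (TropDiff.diffIdeal {TropDiff.linearODE γ β} : Set (TropDiff.DiffPoly k))) := by

  refine ⟨TropDiff.exists_isEnumeration_injOn k, fun a ha => ?_⟩
  have hp0 : PowerSeries.coeff 0 (TropDiff.phi₁ k) = 1 := by simp [TropDiff.coeff_phi₁]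
  have hp1 : PowerSeries.coeff 1 (TropDiff.phi₁ k) = 0 := by simp [TropDiff.coeff_phi₁]
  have hq0 : PowerSeries.coeff 0 (TropDiff.phi₂ a) = 0 := by
    rw [TropDiff.coeff_phi₂ ha.zero ha.one, ha.zero]
  have hq1 : PowerSeries.coeff 1 (TropDiff.phi₂ a) = 1 := by
    rw [TropDiff.coeff_phi₂ ha.zero ha.one, ha.one]
  obtain ⟨γ, β, h₁, h₂⟩ := TropDiff.exists_linearODE hp0 hq0 hq1
  have hspan := TropDiff.Sol_linearODE_eq_span h₁ h₂ hp0 hp1 hq0 hq1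
  have huniv : TropDiff.BoolSeries.ofSet Set.univ ∈
      TropDiff.TropSol (TropDiff.trop ''
        (TropDiff.diffIdeal {TropDiff.linearODE γ β} : Set (TropDiff.DiffPoly k))) := by
    refine TropDiff.univ_mem_tropSol fun n => ?_
    rw [hspan]
    exact TropDiff.exists_mem_span_coeff_ne_zero ha.zero ha.one n
  have hnot : TropDiff.BoolSeries.ofSet Set.univ ∉
      TropDiff.supp '' TropDiff.Sol {TropDiff.linearODE γ β} := by
    rw [hspan]
    rintro ⟨y, hy, h⟩
    exact TropDiff.supp_ne_univ_of_mem_span ha hy h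
  refine ⟨γ, β, (TropDiff.isRecurrence_iff ha.zero ha.one).2 ⟨h₁, h₂⟩, fun γ' β' h => ?_, hspan,
    TropDiff.linearIndependent_phi ha.zero ha.one, fun γ' β' h => ?_, TropDiff.supp_phi₁,
    TropDiff.supp_phi₂ ha, fun hinj y hy hy0 => ?_, ?_, huniv, hnot, fun h => ?_⟩
  · obtain ⟨h₁', h₂'⟩ := (TropDiff.isRecurrence_iff ha.zero ha.one).1 h
    exact TropDiff.linearODE_unique hp0 hq0 hq1 h₁ h₂ h₁' h₂'
  · refine TropDiff.linearODE_unique hp0 hq0 hq1 h₁ h₂ ?_ ?_ <;> rw [h]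
    · exact Submodule.subset_span (Set.mem_insert _ _)
    · exact Submodule.subset_span (Set.mem_insert_of_mem _ rfl)
  · rw [hspan] at hy
    exact TropDiff.exists_supp_eq_compl_singleton ha hinj hy hy0
  · rw [TropDiff.supp_phi₁, TropDiff.supp_phi₂ ha, TropDiff.BoolSeries.ofSet_add]
    congr 1
    ext i
    simp only [Set.mem_union, Set.mem_compl_singleton_iff, Set.mem_univ, iff_true]
    omega
  · exact hnot (h ▸ huniv)
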